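/- Let $d,s\ge 1$ be integers and let $M$ be an integer $s\times s$ matrix. Let $E^+\subset\mathbb R^s$ be the strictly expanding subspace of $M^{\mathsf T}$, i.e. the real subspace spanned by the (real parts and imaginary parts of) generalized eigenvectors of $M^{\mathsf T}$ belonging to eigenvalues of modulus $>1$. Let $\|\cdot\|$ be the maximum norm on $\mathbb R^s$, and for $z\in\mathbb R^s$, $n\ge 0$ put $$\varepsilon_n(z)=\|(M^{\mathsf T})^n z\|_{\mathbb R^s/\mathbb Z^s}=\min_{k\in\mathbb Z^s}\|(M^{\mathsf T})^n z-k\|.$$ A set $\mathcal M$ of real $d\times s$ matrices is called a deformation family if its elements are uniformly bounded and there are $d$ columns such that the determinant of the corresponding $d\times d$ submatrix is bounded away from zero in modulus by some $c>0$, uniformly over $\mathcal M$. For such $\mathcal M$ and for $\rho,\delta>0$, $B>1$, $N\in\mathbb N$ define $$E_N(\rho,\delta,B)=\bigl\{z\in\mathbb R^s:\ B^{-1}\le\|z\|\le B,\ \ |\{1\le n\le N:\ \varepsilon_n(z)\ge\rho\}|<\delta N\bigr\},$$ $$\mathcal E_N(\rho,\delta,B)=\bigl\{L\in\mathcal M:\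 \exists\,\lambda\in\mathbb R^d,\ L^{\mathsf T}\lambda\in E_N(\rho,\delta,B)\bigr\},\qquad \mathfrak E(\rho,\delta,B)=\bigcap_{N_0=1}^\infty\bigcup_{N=N_0}^\infty\mathcal E_N(\rho,\delta,B).$$ Then there is $\rho>0$ such that for every $\varepsilon_1>0$ there is $\delta_0>0$ such that for all $0<\delta<\delta_0$, all deformation families $\mathcal M$ and all $B>1$, $$\dim_H\bigl(\mathfrak E(\rho,\delta,B)\bigr)\le sd-\dim E^+ + d+\varepsilon_1 .$$ -/

import Mathlib

open scoped Matrix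

attribute [local instance] Matrix.normedAddCommGroup

namespace SpectralCocycle

noncomputable section

/-- The strictly expanding subspace of a real square matrix `A` acting on `ℝ^s`: the real vectors
that lie in the (complex) span of the generalized eigenvectors of `A` belonging to eigenvalues of
modulus strictly greater than one. -/
def expandingSubspace {s : ℕ} (A : Matrix (Fin s) (Fin s) ℝ) : Submodule ℝ (Fin s → ℝ) :=
  ((⨆ (μ : ℂ) (_ : 1 < ‖μ‖),
      Module.End.maxGenEigenspace (Matrix.toLin' (A.map (algebraMap ℝ ℂ))) μ).restrictScalars
      ℝ).comap
    (LinearMap.compLeft (Algebra.linearMap ℝ ℂ) (Fin s))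

/-- The distance (in the maximum norm) from `x ∈ ℝ^s` to the lattice `ℤ^s`. -/
def latticeDist {s : ℕ} (x : Fin s → ℝ) : ℝ :=
  Metric.infDist x (Set.range fun k : Fin s → ℤ => fun i => (k i : ℝ))

/-- `ε_n(z) = ‖(Mᵀ)ⁿ z‖_{ℝ^s/ℤ^s}`. -/
def orbitDist {s : ℕ} (M : Matrix (Fin s) (Fin s) ℤ) (n : ℕ) (z : Fin s → ℝ) : ℝ :=
  latticeDist (((M.map (Int.cast : ℤ → ℝ))ᵀ ^ n) *ᵥ z)

/-- The set `E_N(ρ, δ, B)` of vectors `z` with `1/B ≤ ‖z‖ ≤ B` for which fewer than `δ N` of the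
times `1 ≤ n ≤ N` satisfy `ε_n(z) ≥ ρ`. -/
def exceptionalVectors {s : ℕ} (M : Matrix (Fin s) (Fin s) ℤ) (ρ δ B : ℝ) (N : ℕ) :
    Set (Fin s → ℝ) :=
  {z | B⁻¹ ≤ ‖z‖ ∧ ‖z‖ ≤ B ∧
    (({n : ℕ | 1 ≤ n ∧ n ≤ N ∧ ρ ≤ orbitDist M n z}.ncard : ℕ) : ℝ) < δ * N}

/-- The matrices `L` in the family `𝓜` for which `Lᵀ λ ∈ E_N(ρ, δ, B)` for some `λ ∈ ℝ^d`. -/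
def exceptionalMatrices {d s : ℕ} (M : Matrix (Fin s) (Fin s) ℤ)
    (𝓜 : Set (Matrix (Fin d) (Fin s) ℝ)) (ρ δ B : ℝ) (N : ℕ) :
    Set (Matrix (Fin d) (Fin s) ℝ) :=
  {L | L ∈ 𝓜 ∧ ∃ l : Fin d → ℝ, Lᵀ *ᵥ l ∈ exceptionalVectors M ρ δ B N}

/-- The limsup set `⋂_{N₀ ≥ 1} ⋃_{N ≥ N₀}` of the sets of exceptional matrices. -/
def limsupExceptionalSet {d s : ℕ} (M : Matrix (Fin s) (Fin s) ℤ)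
    (𝓜 : Set (Matrix (Fin d) (Fin s) ℝ)) (ρ δ B : ℝ) :
    Set (Matrix (Fin d) (Fin s) ℝ) :=
  ⋂ (N₀ : ℕ) (_ : 1 ≤ N₀), ⋃ (N : ℕ) (_ : N₀ ≤ N), exceptionalMatrices M 𝓜 ρ δ B N

/-- A family of `d × s` deformation matrices: uniformly bounded, and for one fixed choice of `d`
columns the corresponding `d × d` minor is uniformly bounded away from zero. -/
def IsDeformationFamily {d s : ℕ} (𝓜 : Set (Matrix (Fin d) (Fin s) ℝ)) : Prop :=
  (∃ R : ℝ, ∀ L ∈ 𝓜, ∀ i j, |L i j| ≤ R) ∧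
    ∃ (J : Fin d ↪ Fin s) (c : ℝ), 0 < c ∧ ∀ L ∈ 𝓜, c ≤ |(L.submatrix id J).det|

end

end SpectralCocycle

open Filter Topology
open scoped ENNReal NNReal Matrix

/-! Write A for the transpose of M and z = Lᵀλ. If z is exceptional up to time N, the integer
vectors k n near Aⁿz satisfy k (n+1) = A (k n) unless the orbit is ρ-far from the lattice at time n
or n+1. The errors always lie in a fixed finite set and few are nonzero, so k N takes at most C pᴺ
values, with p as close to 1 as desired once δ is small (`exists_finset_approx_exceptionalVectors`).

Since A expands at some rate θ > 1 modulo m ≤ s - dim E⁺ coordinates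
(`exists_expanding_functional`), k N together with those coordinates at scale θ⁻ᴺ determines z at
scale θ⁻ᴺ. Recording also λ and all rows of L except one, whose coefficient in λ is bounded below,
recovers the missing row from Lᵀλ = z (`abs_sub_row_le`). This uses d + s(d-1) + m real numbers at
scale θ⁻ᴺ, and the extra factor pᴺ costs an arbitrarily small dimension; `dimH_limsup_le` turns the
count into the bound. -/

/-! ### Expansion rates from the spectrum -/

/-- An endomorphism all of whose eigenvalues have modulus greater than one expands exponentially. -/
theorem exists_norm_le_mul_norm_pow_of_eigenvalues {V : Type*} [NormedAddCommGroup V]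
    [NormedSpace ℂ V] [FiniteDimensional ℂ V] (T : Module.End ℂ V)
    (hT : ∀ μ : ℂ, T.HasEigenvalue μ → 1 < ‖μ‖) :
    ∃ θ : ℝ, 1 < θ ∧ ∃ C : ℝ, 0 < C ∧ ∀ (N : ℕ) (v : V), ‖v‖ ≤ C * θ⁻¹ ^ N * ‖(T ^ N) v‖ := by
  rcases subsingleton_or_nontrivial V with hV | hV
  · exact ⟨2, one_lt_two, 1, one_pos, fun N v => by simp [Subsingleton.elim v 0]⟩
  have : CompleteSpace V := FiniteDimensional.complete ℂ V
  set Φ := Module.End.toContinuousLinearMap V (𝕜 := ℂ) with hΦ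
  have hspec : ∀ μ ∈ spectrum ℂ (Φ T), 1 < ‖μ‖ := by
    intro μ hμ
    rw [AlgEquiv.spectrum_eq, ← Module.End.hasEigenvalue_iff_mem_spectrum] at hμ
    exact hT μ hμ
  have hunit : IsUnit (Φ T) := by
    rw [← spectrum.zero_notMem_iff ℂ]
    intro h
    have := hspec 0 h
    simp at this
    linarith
  obtain ⟨u, hu⟩ := hunit
  have hrad : spectralRadius ℂ (↑u⁻¹ : V →L[ℂ] V) < (1 : ℝ≥0) := by
    apply spectrum.spectralRadius_lt_of_forall_lt
    intro z hz
    rw [← spectrum.inv₀_mem_iff, hu] at hz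
    have h1 := hspec _ hz
    rw [norm_inv] at h1
    rw [← NNReal.coe_lt_coe]
    simp only [coe_nnnorm, NNReal.coe_one]
    by_contra h
    exact absurd h1 (not_lt.2 (inv_le_one_of_one_le₀ (not_lt.1 h)))
  obtain ⟨κ, hκ1, hκ2⟩ := ENNReal.lt_iff_exists_nnreal_btwn.1 hrad
  have hκ2' : κ < 1 := by exact_mod_cast hκ2
  have hκ0 : 0 < κ := by
    exact ENNReal.coe_pos.1 (lt_of_le_of_lt zero_le hκ1)
  -- Gelfand's formula for the inverse, whose spectral radius is below `κ < 1`.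
  have hev := (spectrum.pow_nnnorm_pow_one_div_tendsto_nhds_spectralRadius
    (↑u⁻¹ : V →L[ℂ] V)).eventually_lt_const hκ1
  obtain ⟨n₀, hn₀⟩ := eventually_atTop.1 hev
  have hbig : ∀ n, n₀ ≤ n → 0 < n → ‖(↑u⁻¹ : V →L[ℂ] V) ^ n‖ ≤ (κ : ℝ) ^ n := by
    intro n hn hn0
    have h := (hn₀ n hn).le
    have h2 := ENNReal.rpow_le_rpow h (Nat.cast_nonneg n : (0 : ℝ) ≤ n)
    have hne : (n : ℝ) ≠ 0 := by positivity
    rw [← ENNReal.rpow_mul, one_div_mul_cancel hne, ENNReal.rpow_one, ENNReal.rpow_natCast] at h2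
    exact_mod_cast h2
  -- The sum absorbs the finitely many exponents up to `n₀`; the 1 serves the tail.
  set C : ℝ := 1 + ∑ i ∈ Finset.range (n₀ + 1), ‖(↑u⁻¹ : V →L[ℂ] V) ^ i‖ / (κ : ℝ) ^ i with hC
  have hκr : (0 : ℝ) < κ := by exact_mod_cast hκ0
  have hCpos : 0 < C := by positivity
  have hall : ∀ n, ‖(↑u⁻¹ : V →L[ℂ] V) ^ n‖ ≤ C * (κ : ℝ) ^ n := by
    intro n
    by_cases hn : n ∈ Finset.range (n₀ + 1)
    · rw [← div_le_iff₀ (by positivity)]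
      have := Finset.single_le_sum (f := fun i => ‖(↑u⁻¹ : V →L[ℂ] V) ^ i‖ / (κ : ℝ) ^ i)
        (fun i _ => by positivity) hn
      linarith
    · rw [Finset.mem_range, not_lt] at hn
      refine (hbig n (by omega) (by omega)).trans ?_
      refine le_mul_of_one_le_left (by positivity) ?_
      rw [hC, le_add_iff_nonneg_right]
      positivity
  refine ⟨(κ : ℝ)⁻¹, (one_lt_inv₀ hκr).2 (by exact_mod_cast hκ2'), C, hCpos, fun N v => ?_⟩
  have hv : ((↑u⁻¹ : V →L[ℂ] V) ^ N) ((Φ T ^ N) v) = v := by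
    have : (↑u⁻¹ : V →L[ℂ] V) ^ N * Φ T ^ N = 1 := by
      rw [← hu, ← Units.val_pow_eq_pow_val, ← Units.val_pow_eq_pow_val, ← Units.val_mul]
      simp
    rw [← mul_apply_eq_comp, this, one_apply_eq_self]
  have hpow : (Φ T ^ N) v = (T ^ N) v := by
    rw [← map_pow]; rfl
  rw [inv_inv]
  calc ‖v‖ = ‖((↑u⁻¹ : V →L[ℂ] V) ^ N) ((Φ T ^ N) v)‖ := by rw [hv]
    _ ≤ ‖(↑u⁻¹ : V →L[ℂ] V) ^ N‖ * ‖(Φ T ^ N) v‖ := ContinuousLinearMap.le_opNorm _ _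
    _ ≤ C * (κ : ℝ) ^ N * ‖(T ^ N) v‖ := by
      rw [hpow]; gcongr; exact hall N

/-- Modulo at most `s - dim E⁺` linear coordinates `P`, a real `s × s` matrix is uniformly
exponentially expanding. -/
theorem exists_expanding_functional {s : ℕ} (A : Matrix (Fin s) (Fin s) ℝ) :
    ∃ (m : ℕ) (P : (Fin s → ℝ) →ₗ[ℝ] (Fin m → ℝ)) (θ C : ℝ), 1 < θ ∧ 0 < C ∧
      m + Module.finrank ℝ (SpectralCocycle.expandingSubspace A) ≤ s ∧
      ∀ (N : ℕ) (u : Fin s → ℝ),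
        ‖u‖ ≤ C * (θ⁻¹ ^ N * ‖(A ^ N).mulVec u‖ + ‖P u‖) := by
  set f : Module.End ℂ (Fin s → ℂ) := Matrix.toLin' (A.map (algebraMap ℝ ℂ)) with hf
  set V : Submodule ℂ (Fin s → ℂ) := ⨆ (μ : ℂ) (_ : 1 < ‖μ‖), f.maxGenEigenspace μ with hV
  set W : Submodule ℂ (Fin s → ℂ) := ⨆ (μ : ℂ) (_ : ¬ 1 < ‖μ‖), f.maxGenEigenspace μ with hW
  have hind := Module.End.independent_maxGenEigenspace f
  have hVW : IsCompl V W := by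
    constructor
    · exact hind.disjoint_biSup_biSup (s := {μ : ℂ | 1 < ‖μ‖}) (t := {μ : ℂ | ¬ 1 < ‖μ‖})
        (Set.disjoint_left.2 fun _ h h' => h' h)
    · rw [codisjoint_iff, eq_top_iff, ← Module.End.iSup_maxGenEigenspace_eq_top f]
      refine iSup_le fun μ => ?_
      by_cases h : 1 < ‖μ‖
      · exact (le_iSup₂ (f := fun (μ : ℂ) (_ : 1 < ‖μ‖) => f.maxGenEigenspace μ) μ h).trans
          le_sup_left
      · exact (le_iSup₂ (f := fun (μ : ℂ) (_ : ¬ 1 < ‖μ‖) => f.maxGenEigenspace μ) μ h).trans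
          le_sup_right
  have hinv : ∀ p : ℂ → Prop, ∀ v ∈ (⨆ (μ : ℂ) (_ : p μ), f.maxGenEigenspace μ),
      f v ∈ (⨆ (μ : ℂ) (_ : p μ), f.maxGenEigenspace μ) := by
    intro p
    change (⨆ (μ : ℂ) (_ : p μ), f.maxGenEigenspace μ) ≤
      Submodule.comap f (⨆ (μ : ℂ) (_ : p μ), f.maxGenEigenspace μ)
    refine iSup₂_le fun μ h v hv => ?_
    exact (le_iSup₂ (f := fun (μ : ℂ) (_ : p μ) => f.maxGenEigenspace μ) μ h)
      (f.mapsTo_maxGenEigenspace_of_comm rfl μ hv)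
  have hfV : ∀ v ∈ V, f v ∈ V := hinv _
  have hfW : ∀ v ∈ W, f v ∈ W := hinv _
  set T : Module.End ℂ V := f.restrict hfV with hT
  -- An eigenvector in `V` with eigenvalue of modulus at most 1 would also lie in `W`, hence vanish.
  have hev : ∀ μ : ℂ, T.HasEigenvalue μ → 1 < ‖μ‖ := by
    intro μ hμ
    by_contra hcon
    obtain ⟨v, hv⟩ := hμ.exists_hasEigenvector
    have h1 : f v = μ • (v : Fin s → ℂ) := congrArg Subtype.val hv.apply_eq_smul
    have h2 : (v : Fin s → ℂ) ∈ f.maxGenEigenspace μ :=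
      (Module.End.mem_maxGenEigenspace f μ _).2 ⟨1, by simp [h1]⟩
    have h3 : (v : Fin s → ℂ) ∈ W :=
      (le_iSup₂ (f := fun (μ : ℂ) (_ : ¬ 1 < ‖μ‖) => f.maxGenEigenspace μ) μ hcon) h2
    exact hv.2 (Subtype.ext (Submodule.disjoint_def.1 hVW.disjoint _ v.2 h3))
  obtain ⟨θ, hθ, C, hC, hTN⟩ := exists_norm_le_mul_norm_pow_of_eigenvalues T hev
  set π : (Fin s → ℂ) →ₗ[ℂ] V := Submodule.projectionOnto V W hVW with hπ
  have hcomm : ∀ x, π (f x) = T (π x) := by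
    intro x
    obtain ⟨v, hv, w, hw, rfl⟩ := Submodule.mem_sup.1
      (hVW.sup_eq_top.symm ▸ Submodule.mem_top : x ∈ V ⊔ W)
    have h1 : π w = 0 := Submodule.projectionOnto_apply_of_mem_right hVW hw
    have h2 : π (f w) = 0 := Submodule.projectionOnto_apply_of_mem_right hVW (hfW w hw)
    have h3 : π v = ⟨v, hv⟩ := Submodule.projectionOnto_apply_left hVW ⟨v, hv⟩
    have h4 : π (f v) = ⟨f v, hfV v hv⟩ :=
      Submodule.projectionOnto_apply_left hVW ⟨f v, hfV v hv⟩
    rw [map_add, map_add, map_add, h1, h2, h3, h4, add_zero, add_zero]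
    rfl
  set c : (Fin s → ℝ) →ₗ[ℝ] (Fin s → ℂ) := LinearMap.compLeft (Algebra.linearMap ℝ ℂ) (Fin s)
  set g : (Fin s → ℝ) →ₗ[ℝ] V := (π.restrictScalars ℝ).comp c with hg
  have hcA : ∀ x, c (A.mulVec x) = f (c x) := by
    intro x
    ext i
    simp [c, hf, Matrix.mulVec, dotProduct]
  have hgN : ∀ N x, g ((A ^ N).mulVec x) = (T ^ N) (g x) := by
    intro N
    induction N with
    | zero => intro x; simp
    | succ N ih =>
      intro x
      rw [pow_succ, ← Matrix.mulVec_mulVec, ih, pow_succ]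
      change _ = (T ^ N) (T (g x))
      congr 1
      change π (c _) = T (π (c x))
      rw [hcA, hcomm]
  -- `π` is the identity on `V`, so `g` is injective on E⁺; this bounds dim ker `g` by s - dim E⁺.
  have hker : Disjoint (LinearMap.ker g) (SpectralCocycle.expandingSubspace A) := by
    rw [Submodule.disjoint_def]
    intro x hx hx'
    have h1 : c x ∈ V := hx'
    have h2 : π (c x) = 0 := hx
    have h3 : π (c x) = ⟨c x, h1⟩ := Submodule.projectionOnto_apply_left hVW ⟨c x, h1⟩
    rw [h3] at h2
    have h4 : c x = 0 := congrArg Subtype.val h2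
    ext i
    have h5 := congrFun h4 i
    simpa [c] using h5
  obtain ⟨K', hK'⟩ := Submodule.exists_isCompl (LinearMap.ker g)
  let b := Module.finBasis ℝ (LinearMap.ker g)
  let P : (Fin s → ℝ) →ₗ[ℝ] (Fin (Module.finrank ℝ (LinearMap.ker g)) → ℝ) :=
    b.equivFun.toLinearMap.comp (Submodule.projectionOnto (LinearMap.ker g) K' hK')
  -- `P` supplies coordinates on ker `g`, so `H` is injective and therefore bounded below.
  let H : (Fin s → ℝ) →ₗ[ℝ] V × (Fin (Module.finrank ℝ (LinearMap.ker g)) → ℝ) := g.prod P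
  have hH : LinearMap.ker H = ⊥ := by
    rw [LinearMap.ker_eq_bot']
    intro x hx
    have h1 : g x = 0 := congrArg Prod.fst hx
    have h2 : P x = 0 := congrArg Prod.snd hx
    have h3 : Submodule.projectionOnto (LinearMap.ker g) K' hK' x = ⟨x, h1⟩ :=
      Submodule.projectionOnto_apply_left hK' ⟨x, h1⟩
    have h4 : b.equivFun (Submodule.projectionOnto (LinearMap.ker g) K' hK' x) = 0 := h2
    rw [h3, LinearEquiv.map_eq_zero_iff] at h4
    exact congrArg Subtype.val h4
  obtain ⟨a, ha, hanti⟩ := LinearMap.exists_antilipschitzWith H hH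
  have hgc : Continuous g := g.continuous_of_finiteDimensional
  obtain ⟨G, hG, hGle⟩ := (⟨g, hgc⟩ : (Fin s → ℝ) →L[ℝ] V).bound
  refine ⟨_, P, θ, a * (C * G + 1), hθ, by positivity, ?_, ?_⟩
  · have h2 := Submodule.finrank_sup_add_finrank_inf_eq (LinearMap.ker g)
      (SpectralCocycle.expandingSubspace A)
    rw [hker.eq_bot, finrank_bot, add_zero] at h2
    rw [← h2]
    exact (Submodule.finrank_le _).trans_eq (by simp)
  · intro N u
    have h1 := hanti.le_mul_dist u 0
    rw [map_zero, dist_zero_right, dist_zero_right] at h1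
    have h2 : ‖H u‖ ≤ ‖g u‖ + ‖P u‖ :=
      max_le (le_add_of_nonneg_right (norm_nonneg _)) (le_add_of_nonneg_left (norm_nonneg _))
    have h3 : ‖g u‖ ≤ C * θ⁻¹ ^ N * (G * ‖(A ^ N).mulVec u‖) := by
      refine (hTN N (g u)).trans ?_
      rw [← hgN]
      have hθ0 : 0 < θ := one_pos.trans hθ
      gcongr
      exact hGle _
    have hθ0 : 0 < θ := one_pos.trans hθ
    have h4 : 0 ≤ θ⁻¹ ^ N * ‖(A ^ N).mulVec u‖ := by positivity
    have h5 : 0 ≤ C * G * ‖P u‖ := by positivity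
    calc ‖u‖ ≤ a * (‖g u‖ + ‖P u‖) := h1.trans (by gcongr)
      _ ≤ a * ((C * G + 1) * (θ⁻¹ ^ N * ‖(A ^ N).mulVec u‖ + ‖P u‖)) := by
        gcongr; nlinarith
      _ = _ := by ring

/-! ### Counting pseudo-orbits with few errors -/

/-- Weighted count of the endpoints of pseudo-orbits of `A` that start in `F₀`, have all errors in
`D`, and have at most `j` nonzero errors among the first `N`. -/
theorem exists_finset_reachable {G : Type*} [AddCommGroup G] [DecidableEq G] (A : G → G) (F₀ D : Finset G)
    (x : ℝ) (hx : 0 < x) (hx1 : x ≤ 1)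
    (N : ℕ) :
    ∀ j : ℕ, ∃ F : Finset G, (F.card : ℝ) * x ^ j ≤ F₀.card * (1 + D.card * x) ^ N ∧
      ∀ k : ℕ → G, k 0 ∈ F₀ → (∀ n < N, k (n + 1) - A (k n) ∈ D) →
        {n ∈ Finset.range N | k (n + 1) ≠ A (k n)}.card ≤ j → k N ∈ F := by
  induction N with
  | zero =>
    intro j
    refine ⟨F₀, ?_, fun k hk _ _ => hk⟩
    rw [pow_zero]
    gcongr
    exact pow_le_one₀ hx.le hx1
  | succ N ih =>
    have hsplit : ∀ k : ℕ → G, {n ∈ Finset.range (N + 1) | k (n + 1) ≠ A (k n)}.card =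
        {n ∈ Finset.range N | k (n + 1) ≠ A (k n)}.card +
          if k (N + 1) = A (k N) then 0 else 1 := by
      intro k
      rw [Finset.card_filter, Finset.card_filter, Finset.sum_range_succ]
      simp
    intro j
    rcases j with _ | j
    · obtain ⟨F, hF, hk⟩ := ih 0
      refine ⟨F.image A, ?_, fun k h0 hD hj => ?_⟩
      · have h1 : ((F.image A).card : ℝ) ≤ F.card := by exact_mod_cast Finset.card_image_le
        rw [pow_zero, mul_one] at hF ⊢
        refine h1.trans (hF.trans ?_)
        gcongr
        · exact le_add_of_nonneg_right (by positivity)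
        · exact Nat.le_succ N
      · rw [hsplit] at hj
        have h1 : k (N + 1) = A (k N) := by
          by_contra h; simp [h] at hj
        rw [h1]
        exact Finset.mem_image_of_mem A (hk k h0 (fun n hn => hD n (by omega)) (by omega))
    -- Pascal-type recursion on the last transition: it is exact with up to `j + 1` earlier errors,
    -- or it spends one error from `D` with up to `j` before. The weight `x ^ j` makes the two cases
    -- add up to one factor `1 + D.card * x`.
    · obtain ⟨F, hF, hk⟩ := ih (j + 1)
      obtain ⟨F', hF', hk'⟩ := ih j
      refine ⟨F.image A ∪ (F' ×ˢ D).image (fun p => A p.1 + p.2), ?_, fun k h0 hD hj => ?_⟩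
      · have h1 : ((F.image A ∪ (F' ×ˢ D).image (fun p => A p.1 + p.2)).card : ℝ) ≤
            F.card + F'.card * D.card := by
          have := (Finset.card_union_le (F.image A) ((F' ×ˢ D).image (fun p => A p.1 + p.2))).trans
            (add_le_add Finset.card_image_le Finset.card_image_le)
          rw [Finset.card_product] at this
          exact_mod_cast this
        calc _ ≤ ((F.card : ℝ) + F'.card * D.card) * x ^ (j + 1) := by gcongr
          _ = F.card * x ^ (j + 1) + (D.card * x) * (F'.card * x ^ j) := by ring
          _ ≤ F₀.card * (1 + D.card * x) ^ N +
              (D.card * x) * (F₀.card * (1 + D.card * x) ^ N) := by gcongr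
          _ = _ := by ring
      · rw [hsplit] at hj
        rw [Finset.mem_union]
        by_cases h : k (N + 1) = A (k N)
        · left
          rw [h]
          exact Finset.mem_image_of_mem A
            (hk k h0 (fun n hn => hD n (by omega)) (by simpa [h] using hj))
        · right
          refine Finset.mem_image.2 ⟨(k N, k (N + 1) - A (k N)), ?_, by simp⟩
          rw [Finset.mem_product]
          exact ⟨hk' k h0 (fun n hn => hD n (by omega)) (by simpa [h] using hj), hD N (by omega)⟩

/-! ### Hausdorff dimension of limsup sets -/

/-- Hausdorff dimension of a limsup set from coverings by exponentially many sets of exponentially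
small diameter. -/
theorem dimH_limsup_le {X ι : Type*} [MetricSpace X] (E : ℕ → Set X) (S : ℕ → Finset ι)
    (U : ℕ → ι → Set X) (D C K q θ : ℝ) (hD : 0 ≤ D) (hK : 0 ≤ K) (hq : 0 ≤ q)
    (hθ : 1 < θ) (hqθ : q < θ ^ D) (hcover : ∀ N, E N ⊆ ⋃ t ∈ S N, U N t)
    (hdiam : ∀ N, ∀ t ∈ S N, ∀ x ∈ U N t, ∀ y ∈ U N t, dist x y ≤ K * θ⁻¹ ^ N)
    (hcard : ∀ N, ((S N).card : ℝ) ≤ C * q ^ N) :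
    dimH (⋂ (N₀ : ℕ) (_ : 1 ≤ N₀), ⋃ (N : ℕ) (_ : N₀ ≤ N), E N) ≤ ENNReal.ofReal D := by
  borelize X
  have hθ0 : 0 < θ := one_pos.trans hθ
  set L := ⋂ (N₀ : ℕ) (_ : 1 ≤ N₀), ⋃ (N : ℕ) (_ : N₀ ≤ N), E N with hL
  -- Up to a constant, stage `N` contributes `p ^ N` to the `D`-dimensional Hausdorff sum.
  set p : ℝ := q * θ⁻¹ ^ D with hp
  have hp0 : 0 ≤ p := by positivity
  have hp1 : p < 1 := by
    rw [hp, Real.inv_rpow hθ0.le, ← div_eq_mul_inv, div_lt_one (by positivity)]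
    exact hqθ
  have hterm : ∀ N, ∑ t ∈ S N, Metric.ediam (U N t) ^ D ≤ ENNReal.ofReal (C * K ^ D * p ^ N) := by
    intro N
    have h1 : ∀ t ∈ S N, Metric.ediam (U N t) ^ D ≤ ENNReal.ofReal (K ^ D * (θ⁻¹ ^ D) ^ N) := by
      intro t ht
      have h2 : Metric.ediam (U N t) ≤ ENNReal.ofReal (K * θ⁻¹ ^ N) := by
        refine Metric.ediam_le fun x hx y hy => ?_
        rw [edist_dist]
        exact ENNReal.ofReal_le_ofReal (hdiam N t ht x hx y hy)
      refine (ENNReal.rpow_le_rpow h2 hD).trans ?_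
      rw [ENNReal.ofReal_rpow_of_nonneg (by positivity) hD, Real.mul_rpow hK (by positivity)]
      rw [← Real.rpow_natCast, ← Real.rpow_natCast, ← Real.rpow_mul (by positivity),
        ← Real.rpow_mul (by positivity), mul_comm D]
    refine (Finset.sum_le_card_nsmul _ _ _ h1).trans ?_
    rw [nsmul_eq_mul, ← ENNReal.ofReal_natCast, ← ENNReal.ofReal_mul (by positivity)]
    refine ENNReal.ofReal_le_ofReal ?_
    refine (mul_le_mul_of_nonneg_right (hcard N) (by positivity)).trans_eq ?_
    rw [hp, mul_pow]; ring
  have hsum : Summable fun N : ℕ => C * K ^ D * p ^ N :=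
    (summable_geometric_of_lt_one hp0 hp1).mul_left _
  -- All stages `N ≥ n` together cover the limsup set, with mesh tending to 0 as `n` grows.
  have hμ : MeasureTheory.Measure.hausdorffMeasure D L ≤
      liminf (fun n : ℕ => ∑' i : (Σ N : {N : ℕ // n ≤ N}, {t // t ∈ S N.1}),
        Metric.ediam (U i.1.1 i.2.1) ^ D) atTop := by
    refine MeasureTheory.Measure.hausdorffMeasure_le_liminf_tsum D L
      (fun n => ENNReal.ofReal (K * θ⁻¹ ^ n)) ?_
      (fun n (i : Σ N : {N : ℕ // n ≤ N}, {t // t ∈ S N.1}) => U i.1.1 i.2.1) ?_ ?_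
    · rw [← ENNReal.ofReal_zero]
      refine ENNReal.tendsto_ofReal ?_
      simpa using (tendsto_pow_atTop_nhds_zero_of_lt_one (by positivity)
        (inv_lt_one_of_one_lt₀ hθ)).const_mul K
    · refine Eventually.of_forall fun n i => ?_
      refine Metric.ediam_le fun x hx y hy => ?_
      rw [edist_dist]
      refine ENNReal.ofReal_le_ofReal ((hdiam _ _ i.2.2 x hx y hy).trans ?_)
      exact mul_le_mul_of_nonneg_left (pow_le_pow_of_le_one (by positivity)
        (inv_le_one_of_one_le₀ hθ.le) i.1.2) hK
    · filter_upwards [eventually_ge_atTop 1] with n hn x hx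
      simp only [hL, Set.mem_iInter, Set.mem_iUnion] at hx
      obtain ⟨N, hN, hxN⟩ := hx n hn
      have := hcover N hxN
      simp only [Set.mem_iUnion] at this
      obtain ⟨t, ht, hxt⟩ := this
      exact Set.mem_iUnion.2 ⟨⟨⟨N, hN⟩, ⟨t, ht⟩⟩, hxt⟩
  have hfin : MeasureTheory.Measure.hausdorffMeasure D L ≠ ⊤ := by
    refine ne_top_of_le_ne_top hsum.tsum_ofReal_ne_top (hμ.trans ?_)
    refine liminf_le_of_le (by isBoundedDefault) fun b hb => ?_
    obtain ⟨n, hn⟩ := hb.exists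
    refine hn.trans ?_
    refine (ENNReal.tsum_sigma (β := fun N : {N : ℕ // n ≤ N} => {t // t ∈ S N.1})
      (fun N t => Metric.ediam (U N.1 t.1) ^ D)).trans_le ?_
    calc _ ≤ ∑' N : {N : ℕ // n ≤ N}, ENNReal.ofReal (C * K ^ D * p ^ N.1) := by
          refine ENNReal.tsum_le_tsum fun N => ?_
          rw [Finset.tsum_subtype (S N.1) (fun t => Metric.ediam (U N.1 t) ^ D)]
          exact hterm N.1
      _ ≤ _ := ENNReal.tsum_comp_le_tsum_of_injective Subtype.val_injective
        (fun N : ℕ => ENNReal.ofReal (C * K ^ D * p ^ N))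
  have := dimH_le_of_hausdorffMeasure_ne_top (d := D.toNNReal) (s := L)
    (by rwa [Real.coe_toNNReal D hD])
  exact this

/-! ### The Erdős–Kahane argument -/

/-- A lattice point strictly closer than `ρ` exists when the distance is below `ρ`; otherwise
coordinatewise rounding serves as the default. The uniform bound 1 keeps pseudo-orbit errors bounded
even at bad times. -/
theorem exists_int_approx {s : ℕ} (x : Fin s → ℝ) (ρ : ℝ) (hρ : ρ ≤ 1) :
    ∃ k : Fin s → ℤ, ‖x - fun i => (k i : ℝ)‖ ≤ 1 ∧
      (SpectralCocycle.latticeDist x < ρ → ‖x - fun i => (k i : ℝ)‖ < ρ) := by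
  by_cases h : SpectralCocycle.latticeDist x < ρ
  · obtain ⟨_, ⟨k, rfl⟩, hk⟩ := (Metric.infDist_lt_iff (Set.range_nonempty _)).1 h
    rw [dist_eq_norm] at hk
    exact ⟨k, hk.le.trans hρ, fun _ => hk⟩
  · refine ⟨fun i => round (x i), ?_, fun h' => absurd h' h⟩
    refine (pi_norm_le_iff_of_nonneg zero_le_one).2 fun i => ?_
    rw [Pi.sub_apply, Real.norm_eq_abs]
    exact (abs_sub_round (x i)).trans (by norm_num)

theorem exists_norm_mulVec_le {m n : ℕ} (A : Matrix (Fin m) (Fin n) ℝ) :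
    ∃ Q : ℝ, 0 < Q ∧ ∀ v, ‖A *ᵥ v‖ ≤ Q * ‖v‖ :=
  (⟨A.mulVecLin, A.mulVecLin.continuous_of_finiteDimensional⟩ :
    (Fin n → ℝ) →L[ℝ] (Fin m → ℝ)).bound

/-- The growth rate of the weighted count is split between its two factors, each at most `√p`: first
`x` is taken small against `K`, then `δ` small against `log x⁻¹`. -/
theorem exists_param_lt {K p : ℝ} (hK : 0 ≤ K) (hp : 1 < p) :
    ∃ x : ℝ, 0 < x ∧ x < 1 ∧ ∃ δ₀ : ℝ, 0 < δ₀ ∧ ∀ δ : ℝ, δ < δ₀ →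
      x⁻¹ ^ (2 * δ) * (1 + K * x) ≤ p := by
  set y := Real.sqrt p with hy
  have hy1 : 1 < y := Real.lt_sqrt_of_sq_lt (by simpa using hp)
  have hyp : y * y = p := Real.mul_self_sqrt (by linarith)
  set x := min (1 / 2) ((y - 1) / (K + 1)) with hx
  have hx0 : 0 < x := lt_min (by norm_num) (div_pos (by linarith) (by linarith))
  have hx1 : x < 1 := (min_le_left _ _).trans_lt (by norm_num)
  have hKx : 1 + K * x ≤ y := by
    have h1 : x * (K + 1) ≤ y - 1 :=
      (le_div_iff₀ (by linarith)).1 (min_le_right _ _)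
    nlinarith
  have hxi : 1 < x⁻¹ := (one_lt_inv₀ hx0).2 hx1
  have hl1 : 0 < Real.log x⁻¹ := Real.log_pos hxi
  refine ⟨x, hx0, hx1, Real.log y / (2 * Real.log x⁻¹), div_pos (Real.log_pos hy1) (by positivity),
    fun δ hδ => ?_⟩
  rw [← hyp]
  refine mul_le_mul ?_ hKx (by positivity) (by linarith)
  rw [← Real.log_le_log_iff (by positivity) (by linarith), Real.log_rpow (by positivity)]
  have := (lt_div_iff₀ (by positivity)).1 hδ
  nlinarith

theorem card_piFinset_Icc (n : ℕ) (q : ℕ) :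
    (Fintype.piFinset fun _ : Fin n => Finset.Icc (-(q : ℤ)) q).card = (2 * q + 1) ^ n := by
  rw [Fintype.card_piFinset]
  simp only [Int.card_Icc, Finset.prod_const, Finset.card_univ, Fintype.card_fin]
  congr 1
  omega

theorem mem_piFinset_Icc_of_norm_le {n : ℕ} (q : ℕ) (k : Fin n → ℤ)
    (h : ‖fun i => (k i : ℝ)‖ ≤ q) :
    k ∈ Fintype.piFinset fun _ : Fin n => Finset.Icc (-(q : ℤ)) q := by
  rw [Fintype.mem_piFinset]
  intro i
  have := (norm_le_pi_norm (fun i => (k i : ℝ)) i).trans h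
  rw [Real.norm_eq_abs, abs_le] at this
  rw [Finset.mem_Icc]
  exact ⟨by exact_mod_cast this.1, by exact_mod_cast this.2⟩

/-- For a suitable `ρ`, the integer points closest to the `N`-th images of exceptional vectors
form a set of arbitrarily small exponential growth rate (the Erdős–Kahane argument). -/
theorem exists_finset_approx_exceptionalVectors {s : ℕ} (M : Matrix (Fin s) (Fin s) ℤ) :
    ∃ ρ : ℝ, 0 < ρ ∧ ∀ p : ℝ, 1 < p → ∃ δ₀ : ℝ, 0 < δ₀ ∧ ∀ δ : ℝ, 0 < δ → δ < δ₀ → ∀ B : ℝ,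
      ∃ C : ℝ, ∀ N : ℕ, ∃ F : Finset (Fin s → ℤ), (F.card : ℝ) ≤ C * p ^ N ∧
        ∀ z ∈ SpectralCocycle.exceptionalVectors M ρ δ B N, ∃ k ∈ F,
          ‖((M.map (Int.cast : ℤ → ℝ))ᵀ ^ N) *ᵥ z - fun i => (k i : ℝ)‖ ≤ 1 := by
  set A := (M.map (Int.cast : ℤ → ℝ))ᵀ with hA
  obtain ⟨Q, hQ0, hQ⟩ := exists_norm_mulVec_le A
  have hAk : ∀ k : Fin s → ℤ, (A *ᵥ fun i => (k i : ℝ)) = fun i => ((Mᵀ *ᵥ k) i : ℝ) := by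
    intro k
    ext i
    simp [hA, Matrix.mulVec, dotProduct]
  -- With `(Q + 1) * ρ = 1`, two consecutive approximations closer than `ρ` leave an integer error
  -- of norm below 1, hence zero.
  set ρ : ℝ := 1 / (Q + 1) with hρ
  have hρ0 : 0 < ρ := by positivity
  have hρQ : (Q + 1) * ρ = 1 := by rw [hρ]; field_simp
  have hρ1 : ρ ≤ 1 := by nlinarith
  obtain ⟨q, hq⟩ := exists_nat_ge (Q + 1)
  set D := Fintype.piFinset fun _ : Fin s => Finset.Icc (-(q : ℤ)) q with hD
  refine ⟨ρ, hρ0, fun p hp => ?_⟩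
  obtain ⟨x, hx0, hx1, δ₀, hδ₀, hδ₀p⟩ := exists_param_lt (K := (D.card : ℝ)) (Nat.cast_nonneg _) hp
  refine ⟨δ₀, hδ₀, fun δ hδ hδlt B => ?_⟩
  obtain ⟨b, hb⟩ := exists_nat_ge (B + 1)
  set F₀ := Fintype.piFinset fun _ : Fin s => Finset.Icc (-(b : ℤ)) b with hF₀
  refine ⟨F₀.card * x⁻¹, fun N => ?_⟩
  obtain ⟨F, hF, hreach⟩ := exists_finset_reachable (fun k => Mᵀ *ᵥ k) F₀ D x hx0 hx1.le N
    -- Each bad time spoils at most the transitions into and out of it; the 1 pays for time 0, which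
    -- the exceptional set does not control.
    ⌊2 * δ * N + 1⌋₊
  refine ⟨F, ?_, ?_⟩
  · have hxi : 1 ≤ x⁻¹ := (one_le_inv₀ hx0).2 hx1.le
    have h1 : x⁻¹ ^ ⌊2 * δ * N + 1⌋₊ ≤ x⁻¹ * (x⁻¹ ^ (2 * δ)) ^ N := by
      rw [← Real.rpow_natCast, ← Real.rpow_natCast, ← Real.rpow_mul (by positivity)]
      refine (Real.rpow_le_rpow_of_exponent_le hxi (Nat.floor_le (by positivity))).trans_eq ?_
      rw [Real.rpow_add (by positivity), Real.rpow_one, mul_comm]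
    have h2 : (F.card : ℝ) = F.card * x ^ ⌊2 * δ * N + 1⌋₊ * x⁻¹ ^ ⌊2 * δ * N + 1⌋₊ := by
      rw [mul_assoc, ← mul_pow, mul_inv_cancel₀ hx0.ne', one_pow, mul_one]
    have h3 := hδ₀p δ hδlt
    have hf : 0 ≤ (F₀.card : ℝ) := Nat.cast_nonneg _
    have hg : 0 ≤ (D.card : ℝ) := Nat.cast_nonneg _
    rw [h2]
    generalize (F₀.card : ℝ) = f at *
    generalize (D.card : ℝ) = g at *
    calc _ ≤ f * (1 + g * x) ^ N * (x⁻¹ * (x⁻¹ ^ (2 * δ)) ^ N) := by gcongr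
      _ = f * x⁻¹ * (x⁻¹ ^ (2 * δ) * (1 + g * x)) ^ N := by rw [mul_pow]; ring
      _ ≤ _ := by gcongr
  · rintro z ⟨-, hzB, hzN⟩
    choose k hk1 hkρ using fun n : ℕ => exists_int_approx (A ^ n *ᵥ z) ρ hρ1
    have hdiff : ∀ n, ‖fun i => ((k (n + 1) - Mᵀ *ᵥ k n) i : ℝ)‖ ≤
        Q * ‖A ^ n *ᵥ z - fun i => (k n i : ℝ)‖ +
          ‖A ^ (n + 1) *ᵥ z - fun i => (k (n + 1) i : ℝ)‖ := by
      intro n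
      have h1 : (fun i => ((k (n + 1) - Mᵀ *ᵥ k n) i : ℝ)) =
          A *ᵥ (A ^ n *ᵥ z - fun i => (k n i : ℝ)) -
            (A ^ (n + 1) *ᵥ z - fun i => (k (n + 1) i : ℝ)) := by
        rw [Matrix.mulVec_sub, hAk, Matrix.mulVec_mulVec, ← pow_succ']
        ext i
        simp
      rw [h1]
      refine (norm_sub_le _ _).trans ?_
      gcongr
      exact hQ _
    refine ⟨k N, hreach k ?_ ?_ ?_, hk1 N⟩
    · refine mem_piFinset_Icc_of_norm_le b _ (le_trans ?_ hb)
      have h1 := hk1 0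
      rw [pow_zero, Matrix.one_mulVec, norm_sub_rev] at h1
      have h2 := norm_le_norm_add_norm_sub' (fun i => (k 0 i : ℝ)) z
      linarith
    · intro n _
      refine mem_piFinset_Icc_of_norm_le q _ ((hdiff n).trans (le_trans ?_ hq))
      nlinarith [hk1 n, hk1 (n + 1)]
    · have hbad : ∀ n, k (n + 1) ≠ Mᵀ *ᵥ k n →
          ρ ≤ SpectralCocycle.orbitDist M n z ∨ ρ ≤ SpectralCocycle.orbitDist M (n + 1) z := by
        intro n hn
        by_contra! hcon
        have h1 := hkρ n hcon.1
        have h2 := hkρ (n + 1) hcon.2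
        refine hn (sub_eq_zero.1 ?_)
        ext i
        have h3 : ‖fun i => ((k (n + 1) - Mᵀ *ᵥ k n) i : ℝ)‖ < 1 :=
          (hdiff n).trans_lt (by nlinarith)
        have h4 := (norm_le_pi_norm (fun i => ((k (n + 1) - Mᵀ *ᵥ k n) i : ℝ)) i).trans_lt h3
        rw [Real.norm_eq_abs] at h4
        exact Int.abs_lt_one_iff.1 (by exact_mod_cast h4)
      set T := {n ∈ Finset.Icc 1 N | ρ ≤ SpectralCocycle.orbitDist M n z} with hT
      have hTcard : (T.card : ℝ) < δ * N := by
        rw [← Set.ncard_coe_finset]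
        convert hzN using 4
        ext n
        simp [hT, and_assoc]
      have hsub : {n ∈ Finset.range N | k (n + 1) ≠ Mᵀ *ᵥ k n} ⊆
          insert 0 T ∪ T.image (fun n => n - 1) := by
        intro n hn
        rw [Finset.mem_filter, Finset.mem_range] at hn
        rw [Finset.mem_union, Finset.mem_insert, Finset.mem_image]
        rcases hbad n hn.2 with h | h
        · left
          rcases Nat.eq_zero_or_pos n with h0 | h0
          · exact Or.inl h0
          · exact Or.inr (Finset.mem_filter.2 ⟨Finset.mem_Icc.2 ⟨h0, hn.1.le⟩, h⟩)
        · right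
          exact ⟨n + 1, Finset.mem_filter.2 ⟨Finset.mem_Icc.2 ⟨by omega, hn.1⟩, h⟩, rfl⟩
      refine Nat.le_floor ?_
      have h1 := (Finset.card_le_card hsub).trans ((Finset.card_union_le _ _).trans
        (add_le_add (Finset.card_insert_le 0 T) Finset.card_image_le))
      have h2 : (({n ∈ Finset.range N | k (n + 1) ≠ Mᵀ *ᵥ k n}.card : ℕ) : ℝ) ≤
        (T.card + 1) + T.card := by exact_mod_cast h1
      linarith

/-! ### Recovering a matrix from discretized data -/

/-- If `Lᵀ l`, `l` and all rows of `L` but the `i`-th are known up to `O(r)`, where `|l i| ≥ c`, then so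
is the `i`-th row of `L`. -/
theorem abs_sub_row_le {d s : ℕ} {L L' : Matrix (Fin d) (Fin s) ℝ} {l l' : Fin d → ℝ}
    {R c K r : ℝ} (hc : 0 < c) (hR : 0 ≤ R) (hr : 0 ≤ r) {i : Fin d} (hi : c ≤ |l i|)
    (hl : ∀ j, |l j| ≤ R) (hL' : ∀ j k, |L' j k| ≤ R) (hll : ∀ j, |l j - l' j| ≤ r)
    (k : Fin s) (hrow : ∀ j, j ≠ i → |L j k - L' j k| ≤ r)
    (hz : |(Lᵀ *ᵥ l) k - (L'ᵀ *ᵥ l') k| ≤ K * r) :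
    |L i k - L' i k| ≤ (K + 2 * d * R) / c * r := by
  have h1 : (L i k - L' i k) * l i = ((Lᵀ *ᵥ l) k - (L'ᵀ *ᵥ l') k)
      - ∑ j, L' j k * (l j - l' j) - ∑ j ∈ Finset.univ.erase i, (L j k - L' j k) * l j := by
    have h2 : ∑ j, (L j k - L' j k) * l j = (L i k - L' i k) * l i +
        ∑ j ∈ Finset.univ.erase i, (L j k - L' j k) * l j :=
      (Finset.add_sum_erase _ _ (Finset.mem_univ i)).symm
    have h3 : ∑ j, (L j k - L' j k) * l j = ((Lᵀ *ᵥ l) k - (L'ᵀ *ᵥ l') k)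
        - ∑ j, L' j k * (l j - l' j) := by
      simp only [Matrix.mulVec, dotProduct, Matrix.transpose_apply]
      rw [← Finset.sum_sub_distrib, ← Finset.sum_sub_distrib]
      refine Finset.sum_congr rfl fun j _ => by ring
    linarith
  have h4 : |∑ j, L' j k * (l j - l' j)| ≤ d * (R * r) := by
    refine (Finset.abs_sum_le_sum_abs _ _).trans ((Finset.sum_le_card_nsmul _ _ (R * r)
      fun j _ => ?_).trans_eq (by simp))
    rw [abs_mul]
    exact mul_le_mul (hL' j k) (hll j) (abs_nonneg _) hR
  have h5 : |∑ j ∈ Finset.univ.erase i, (L j k - L' j k) * l j| ≤ d * (R * r) := by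
    refine (Finset.abs_sum_le_sum_abs _ _).trans ((Finset.sum_le_card_nsmul _ _ (R * r)
      fun j hj => ?_).trans ?_)
    · rw [abs_mul, mul_comm R]
      exact mul_le_mul (hrow j (Finset.ne_of_mem_erase hj)) (hl j) (abs_nonneg _) hr
    · rw [nsmul_eq_mul]
      gcongr
      exact (Finset.card_erase_le).trans (by simp)
  have h6 : |L i k - L' i k| * c ≤ (K + 2 * d * R) * r := by
    calc |L i k - L' i k| * c ≤ |L i k - L' i k| * |l i| := by gcongr
      _ = |(L i k - L' i k) * l i| := (abs_mul _ _).symm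
      _ ≤ K * r + d * (R * r) + d * (R * r) := by
        rw [h1]
        exact (abs_sub _ _).trans (add_le_add ((abs_sub _ _).trans (add_le_add hz h4)) h5)
      _ = _ := by ring
  rw [div_mul_eq_mul_div, le_div_iff₀ hc]
  exact h6

/-- Cramer's rule on the distinguished minor bounds `l` above, as the minor is at least `c₀` in
modulus. Conversely, if every `l i` were tiny then `Lᵀ *ᵥ l` would have norm below `B⁻¹`. -/
theorem SpectralCocycle.IsDeformationFamily.exists_bounds {d s : ℕ}
    {𝓜 : Set (Matrix (Fin d) (Fin s) ℝ)} (h : SpectralCocycle.IsDeformationFamily 𝓜)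
    {B : ℝ} (hB : 0 < B) :
    ∃ R c : ℝ, 0 ≤ R ∧ 0 < c ∧ ∀ L ∈ 𝓜, ∀ l : Fin d → ℝ, B⁻¹ ≤ ‖Lᵀ *ᵥ l‖ → ‖Lᵀ *ᵥ l‖ ≤ B →
      (∀ i j, |L i j| ≤ R) ∧ (∀ i, |l i| ≤ R) ∧ ∃ i, c ≤ |l i| := by
  obtain ⟨⟨R₀, hR₀⟩, J, c₀, hc₀, hdet⟩ := h
  set x := max (max R₀ B) 0 with hx
  have hxR : R₀ ≤ x := (le_max_left _ _).trans (le_max_left _ _)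
  have hxB : B ≤ x := (le_max_right _ _).trans (le_max_left _ _)
  have hx0 : 0 ≤ x := le_max_right _ _
  set Λ : ℝ := d.factorial * x ^ d / c₀ with hΛ
  have hΛ0 : 0 ≤ Λ := by positivity
  set R := max x Λ with hR
  have hR0 : 0 ≤ R := hx0.trans (le_max_left _ _)
  set c := B⁻¹ / (d * R + 1) with hc
  have hc0 : 0 < c := by positivity
  refine ⟨R, c, hR0, hc0, fun L hL l hl1 hl2 => ⟨fun i j => ((hR₀ L hL i j).trans hxR).trans
    (le_max_left _ _), fun i => le_trans ?_ (le_max_right _ _), ?_⟩⟩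
  · set S := (L.submatrix id J)ᵀ with hS
    have hSl : ∀ a, (S *ᵥ l) a = (Lᵀ *ᵥ l) (J a) := fun a => rfl
    have h1 : S.det * l i = (S.updateCol i (S *ᵥ l)).det := by
      rw [← Matrix.cramer_apply, Matrix.cramer_eq_adjugate_mulVec, Matrix.mulVec_mulVec,
        Matrix.adjugate_mul, Matrix.smul_mulVec, Matrix.one_mulVec]
      rfl
    have h2 : |(S.updateCol i (S *ᵥ l)).det| ≤ d.factorial * x ^ d := by
      have := Matrix.det_le (A := S.updateCol i (S *ᵥ l)) (abv := AbsoluteValue.abs) (x := x)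
        (fun a b => by
          rw [AbsoluteValue.abs_apply, Matrix.updateCol_apply]
          split_ifs
          · rw [hSl]
            exact ((norm_le_pi_norm (Lᵀ *ᵥ l) (J a)).trans hl2).trans hxB
          · exact (hR₀ L hL _ _).trans hxR)
      simpa using this
    rw [← h1, abs_mul] at h2
    have h3 : c₀ ≤ |S.det| := by rw [hS, Matrix.det_transpose]; exact hdet L hL
    rw [hΛ, le_div_iff₀ hc₀, mul_comm]
    exact (mul_le_mul_of_nonneg_right h3 (abs_nonneg _)).trans h2
  · by_contra! hcon
    refine absurd hl1 (not_le.2 ((pi_norm_lt_iff (inv_pos.2 hB)).2 fun k => ?_))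
    have h1 : |(Lᵀ *ᵥ l) k| ≤ d * (R * c) := by
      change |∑ j, L j k * l j| ≤ _
      refine (Finset.abs_sum_le_sum_abs _ _).trans ((Finset.sum_le_card_nsmul _ _ (R * c)
        fun j _ => ?_).trans_eq (by simp))
      rw [abs_mul]
      exact mul_le_mul (((hR₀ L hL j k).trans hxR).trans (le_max_left _ _)) (hcon j).le
        (abs_nonneg _) hR0
    refine h1.trans_lt ?_
    have h2 : (d * R + 1) * c = B⁻¹ := by rw [hc]; field_simp
    nlinarith

theorem card_piFinset_ite {d : ℕ} {α : Type*} [Zero α] [DecidableEq α] (T : Finset α) (i : Fin d) :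
    (Fintype.piFinset fun j : Fin d => if j = i then {0} else T).card = T.card ^ (d - 1) := by
  rw [Fintype.card_piFinset]
  simp only [apply_ite Finset.card, Finset.card_singleton]
  rw [Finset.prod_ite, Finset.prod_const_one, one_mul, Finset.prod_const, Finset.filter_ne',
    Finset.card_erase_of_mem (Finset.mem_univ i), Finset.card_univ, Fintype.card_fin]

theorem floor_mul_mem_Icc {x R t : ℝ} {q : ℕ} (ht : 0 ≤ t) (hx : |x| ≤ R) (hq : R * t ≤ q) :
    ⌊x * t⌋ ∈ Finset.Icc (-(q : ℤ)) q := by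
  rw [abs_le] at hx
  rw [Finset.mem_Icc, Int.le_floor]
  have h1 := mul_le_mul_of_nonneg_right hx.1 ht
  have h2 := mul_le_mul_of_nonneg_right hx.2 ht
  refine ⟨by push_cast; linarith, ?_⟩
  have h3 := Int.floor_le (x * t)
  exact_mod_cast (h3.trans h2).trans hq

theorem abs_sub_le_inv_of_floor_mul_eq {x y t : ℝ} (ht : 0 < t) (h : ⌊x * t⌋ = ⌊y * t⌋) :
    |x - y| ≤ t⁻¹ := by
  have h1 := Int.abs_sub_lt_one_of_floor_eq_floor h
  rw [← sub_mul, abs_mul, abs_of_pos ht] at h1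
  rw [← one_div, le_div_iff₀ ht]
  exact h1.le

/-! ### Covering by discretized data and conclusion -/

/-- Dimension bound for the limsup set, given expansion transverse to `m` coordinates and a bound on
the number of approximating integer points. -/
theorem dimH_limsupExceptionalSet_le {d s m : ℕ} (M : Matrix (Fin s) (Fin s) ℤ)
    {ρ δ B θ p C₁ C₂ D : ℝ} (hB : 0 < B) (hθ : 1 < θ) (hp : 0 ≤ p) (hC₁ : 0 < C₁)
    (hD : 0 ≤ D)
    (hpD : θ ^ (d + s * (d - 1) + m) * p < θ ^ D)
    (P : (Fin s → ℝ) →ₗ[ℝ] (Fin m → ℝ))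
    (hP : ∀ (N : ℕ) (u : Fin s → ℝ),
      ‖u‖ ≤ C₁ * (θ⁻¹ ^ N * ‖((M.map (Int.cast : ℤ → ℝ))ᵀ ^ N) *ᵥ u‖ + ‖P u‖))
    (F : ℕ → Finset (Fin s → ℤ)) (hF : ∀ N, ((F N).card : ℝ) ≤ C₂ * p ^ N)
    (hFz : ∀ N, ∀ z ∈ SpectralCocycle.exceptionalVectors M ρ δ B N, ∃ k ∈ F N,
      ‖((M.map (Int.cast : ℤ → ℝ))ᵀ ^ N) *ᵥ z - fun i => (k i : ℝ)‖ ≤ 1)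
    {𝓜 : Set (Matrix (Fin d) (Fin s) ℝ)} (h𝓜 : SpectralCocycle.IsDeformationFamily 𝓜) :
    dimH (SpectralCocycle.limsupExceptionalSet M 𝓜 ρ δ B) ≤ ENNReal.ofReal D := by
  classical
  set A := (M.map (Int.cast : ℤ → ℝ))ᵀ with hA
  have hθ0 : 0 < θ := one_pos.trans hθ
  obtain ⟨R₁, c, hR₁, hc, hbound⟩ := h𝓜.exists_bounds hB
  obtain ⟨G, hG, hGP⟩ := (⟨P, P.continuous_of_finiteDimensional⟩ :
    (Fin s → ℝ) →L[ℝ] (Fin m → ℝ)).bound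
  set R := max R₁ (G * B) with hR
  have hR0 : 0 ≤ R := hR₁.trans (le_max_left _ _)
  let q : ℕ → ℕ := fun N => ⌈R * θ ^ N⌉₊
  have hq : ∀ N, R * θ ^ N ≤ q N := fun N => Nat.le_ceil _
  have hq' : ∀ N, ((2 * q N + 1 : ℕ) : ℝ) ≤ (2 * R + 3) * θ ^ N := by
    intro N
    have h1 : (q N : ℝ) < R * θ ^ N + 1 := Nat.ceil_lt_add_one (by positivity)
    have h2 : 1 ≤ θ ^ N := one_le_pow₀ hθ.le
    push_cast
    linarith
  let box : ℕ → (n : ℕ) → Finset (Fin n → ℤ) := fun N n =>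
    Fintype.piFinset fun _ => Finset.Icc (-(q N : ℤ)) (q N)
  -- A label holds the index `i` of the omitted row, then `l`, the other rows, the integer point and
  -- the `P`-coordinates. The omitted row is frozen at 0 so that it adds nothing to the count.
  let S : ℕ → Finset (Fin d × (Fin d → ℤ) × (Fin d → Fin s → ℤ) × (Fin s → ℤ) × (Fin m → ℤ)) :=
    fun N => Finset.univ.biUnion fun i => {i} ×ˢ box N d ×ˢ
      (Fintype.piFinset fun j : Fin d => if j = i then {0} else box N s) ×ˢ F N ×ˢ box N m
  let U : ℕ → (Fin d × (Fin d → ℤ) × (Fin d → Fin s → ℤ) × (Fin s → ℤ) × (Fin m → ℤ)) →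
      Set (Matrix (Fin d) (Fin s) ℝ) := fun N t =>
    {L | ∃ l : Fin d → ℝ, (∀ i j, |L i j| ≤ R) ∧ (∀ i, |l i| ≤ R) ∧ c ≤ |l t.1| ∧
      (∀ j, ⌊l j * θ ^ N⌋ = t.2.1 j) ∧ (∀ j, j ≠ t.1 → ∀ k, ⌊L j k * θ ^ N⌋ = t.2.2.1 j k) ∧
      ‖(A ^ N) *ᵥ (Lᵀ *ᵥ l) - fun i => (t.2.2.2.1 i : ℝ)‖ ≤ 1 ∧
      ∀ j, ⌊P (Lᵀ *ᵥ l) j * θ ^ N⌋ = t.2.2.2.2 j}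
  refine dimH_limsup_le (SpectralCocycle.exceptionalMatrices M 𝓜 ρ δ B) S U D
    (d * (2 * R + 3) ^ (d + s * (d - 1) + m) * C₂)
    ((3 * C₁ + 2 * d * R) / c + 1) (θ ^ (d + s * (d - 1) + m) * p) θ hD (by positivity)
    (by positivity) hθ hpD ?_ ?_ ?_
  · rintro N L ⟨hL, l, hz⟩
    obtain ⟨hLR, hlR, i, hi⟩ := hbound L hL l hz.1 hz.2.1
    obtain ⟨k, hk, hkz⟩ := hFz N _ hz
    have hLR' : ∀ i j, |L i j| ≤ R := fun i j => (hLR i j).trans (le_max_left _ _)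
    have hlR' : ∀ i, |l i| ≤ R := fun i => (hlR i).trans (le_max_left _ _)
    have hPR : ∀ j, |P (Lᵀ *ᵥ l) j| ≤ R := fun j => by
      refine le_trans ?_ (le_max_right _ _)
      refine (norm_le_pi_norm (P (Lᵀ *ᵥ l)) j).trans ((hGP _).trans ?_)
      gcongr
      exact hz.2.1
    have ht : 0 ≤ θ ^ N := by positivity
    simp only [Set.mem_iUnion]
    refine ⟨(i, fun j => ⌊l j * θ ^ N⌋, fun j k => if j = i then 0 else ⌊L j k * θ ^ N⌋, k,
      fun j => ⌊P (Lᵀ *ᵥ l) j * θ ^ N⌋), ?_, l, hLR', hlR', hi, fun j => rfl, ?_, hkz, fun j => rfl⟩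
    · refine Finset.mem_biUnion.2 ⟨i, Finset.mem_univ i, ?_⟩
      simp only [Finset.mem_product, Finset.mem_singleton, true_and]
      refine ⟨?_, ?_, hk, ?_⟩
      · exact Fintype.mem_piFinset.2 fun j => floor_mul_mem_Icc ht (hlR' j) (hq N)
      · refine Fintype.mem_piFinset.2 fun j => ?_
        split_ifs with hj
        · exact Finset.mem_singleton.2 rfl
        · exact Fintype.mem_piFinset.2 fun k => floor_mul_mem_Icc ht (hLR' j k) (hq N)
      · exact Fintype.mem_piFinset.2 fun j => floor_mul_mem_Icc ht (hPR j) (hq N)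
    · intro j hj k
      simp [hj]
  · rintro N ⟨i, a, Y, k, w⟩ - L ⟨l, hL, hl, hli, hla, hLY, hk, hw⟩ L'
      ⟨l', hL', hl', hli', hla', hLY', hk', hw'⟩
    simp only at hli hla hLY hk hw hla' hLY' hk' hw'
    have ht : 0 < θ ^ N := by positivity
    set r := θ⁻¹ ^ N with hr
    have hrt : r = (θ ^ N)⁻¹ := inv_pow _ _
    have hr0 : 0 ≤ r := by positivity
    set z := Lᵀ *ᵥ l with hz
    set z' := L'ᵀ *ᵥ l' with hz'
    have hrows : ∀ j, j ≠ i → ∀ k, |L j k - L' j k| ≤ r := fun j hj k => by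
      rw [hrt]
      exact abs_sub_le_inv_of_floor_mul_eq ht ((hLY j hj k).trans (hLY' j hj k).symm)
    have hll : ∀ j, |l j - l' j| ≤ r := fun j => by
      rw [hrt]
      exact abs_sub_le_inv_of_floor_mul_eq ht ((hla j).trans (hla' j).symm)
    have hPz : ‖P (z - z')‖ ≤ r := by
      refine (pi_norm_le_iff_of_nonneg hr0).2 fun j => ?_
      rw [map_sub, Pi.sub_apply, Real.norm_eq_abs, hrt]
      exact abs_sub_le_inv_of_floor_mul_eq ht ((hw j).trans (hw' j).symm)
    -- Both images lie within 1 of the same integer point.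
    have hAz : ‖(A ^ N) *ᵥ (z - z')‖ ≤ 2 := by
      rw [Matrix.mulVec_sub]
      have := norm_sub_le ((A ^ N) *ᵥ z - fun i => (k i : ℝ)) ((A ^ N) *ᵥ z' - fun i => (k i : ℝ))
      rw [sub_sub_sub_cancel_right] at this
      linarith
    have hzz : ‖z - z'‖ ≤ 3 * C₁ * r := by
      refine (hP N _).trans ?_
      calc _ ≤ C₁ * (r * 2 + r) := by gcongr
        _ = _ := by ring
    rw [dist_eq_norm, Matrix.norm_le_iff (by positivity)]
    intro j k
    rw [Matrix.sub_apply, Real.norm_eq_abs]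
    have hK : 0 ≤ (3 * C₁ + 2 * d * R) / c := by positivity
    by_cases hj : j = i
    · subst hj
      have := abs_sub_row_le hc hR0 hr0 hli hl hL' hll k (fun j hj => hrows j hj k)
        ((norm_le_pi_norm (z - z') k).trans hzz)
      nlinarith
    · have := hrows j hj k
      nlinarith
  · intro N
    have h1 : (S N).card ≤ d * ((2 * q N + 1) ^ d * (((2 * q N + 1) ^ s) ^ (d - 1) *
        ((F N).card * (2 * q N + 1) ^ m))) := by
      refine Finset.card_biUnion_le.trans ((Finset.sum_le_card_nsmul _ _ _
        fun i _ => le_of_eq ?_).trans_eq (by rw [Finset.card_univ, Fintype.card_fin, smul_eq_mul]))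
      simp only [Finset.card_product, card_piFinset_ite, Finset.card_singleton, one_mul, box,
        card_piFinset_Icc]
    have h2 : ((S N).card : ℝ) ≤
        d * (((2 * q N + 1 : ℕ) : ℝ) ^ (d + s * (d - 1) + m) * (F N).card) := by
      refine (Nat.cast_le.2 h1).trans_eq ?_
      rw [pow_add, pow_add, pow_mul]
      push_cast
      ring
    calc ((S N).card : ℝ) ≤
        d * (((2 * R + 3) * θ ^ N) ^ (d + s * (d - 1) + m) * (C₂ * p ^ N)) := by
          refine h2.trans ?_
          gcongr
          · exact hq' N
          · exact hF N
      _ = _ := by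
        rw [mul_pow, mul_pow, ← pow_mul, ← pow_mul, mul_comm N]
        ring

theorem mainTheorem12 (d s : ℕ) (hd : 1 ≤ d) (M : Matrix (Fin s) (Fin s) ℤ) :
    ∃ ρ : ℝ, 0 < ρ ∧ ∀ ε₁ : ℝ, 0 < ε₁ → ∃ δ₀ : ℝ, 0 < δ₀ ∧ ∀ δ : ℝ, 0 < δ → δ < δ₀ →
      ∀ 𝓜 : Set (Matrix (Fin d) (Fin s) ℝ), SpectralCocycle.IsDeformationFamily 𝓜 →
      ∀ B : ℝ, 1 < B →
        dimH (SpectralCocycle.limsupExceptionalSet M 𝓜 ρ δ B) ≤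
          ENNReal.ofReal ((s : ℝ) * d
            - Module.finrank ℝ (SpectralCocycle.expandingSubspace (M.map (Int.cast : ℤ → ℝ))ᵀ)
            + d + ε₁) := by
  obtain ⟨ρ, hρ, h⟩ := exists_finset_approx_exceptionalVectors M
  obtain ⟨m, P, θ, C₁, hθ, hC₁, hm, hP⟩ :=
    exists_expanding_functional (M.map (Int.cast : ℤ → ℝ))ᵀ
  have hθ0 : 0 < θ := one_pos.trans hθ
  refine ⟨ρ, hρ, fun ε₁ hε₁ => ?_⟩
  -- Half of `ε₁` pays for the integer points; the other half makes the comparison of exponents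
  -- strict.
  obtain ⟨δ₀, hδ₀, h⟩ := h (θ ^ (ε₁ / 2)) (Real.one_lt_rpow hθ (by positivity))
  refine ⟨δ₀, hδ₀, fun δ hδ hδlt 𝓜 h𝓜 B hB => ?_⟩
  obtain ⟨C₂, h⟩ := h δ hδ hδlt B
  choose F hF hFz using h
  set e := Module.finrank ℝ (SpectralCocycle.expandingSubspace (M.map (Int.cast : ℤ → ℝ))ᵀ)
  have hle : (((d + s * (d - 1) + m : ℕ) : ℝ)) ≤ (s : ℝ) * d - e + d := by
    have h1 : (m : ℝ) + e ≤ s := by exact_mod_cast hm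
    push_cast [Nat.cast_sub hd]
    linarith
  have h0 : (0 : ℝ) ≤ ((d + s * (d - 1) + m : ℕ) : ℝ) := Nat.cast_nonneg _
  refine dimH_limsupExceptionalSet_le M (one_pos.trans hB) hθ (by positivity) hC₁
    (by linarith) ?_ P hP F hF hFz h𝓜
  rw [← Real.rpow_natCast, ← Real.rpow_add hθ0]
  exact Real.rpow_lt_rpow_of_exponent_lt hθ (by linarith)
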